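/- Let $K$ be a field, let $\sigma$ be an automorphism of $K$ of finite order $n$ with fixed field $F$, and let $R=K[t;\sigma]$ be the twisted polynomial ring, in which $ta=\sigma(a)t$ for $a\in K$. Let $f\in R$ have degree $m\geq 1$ and satisfy $(f,t)_r=1$, i.e. $1$ is a greatest common right divisor of $f$ and $t$. Let $h(t)=\hat h(t^n)$, with $\hat h\in F[x]$ monic, be the minimal central left multiple of $f$: the element of minimal degree among the nonzero elements of the center of $R$ that have the form $gf$ with $g\in R$. Assume that $\hat h$ is irreducible in $F[x]$. Call $f$ a generalised A-polynomial if its eigenring $\mathcal{E}(f)=\{g\in R : fg\in Rf\}/Rf$ is a (finite-dimensional) central simple algebra over $F$. Then the following are equivalent: 1. $f$ is a generalised A-polynomial in $R$; 2. $\hat h(x)=x-a$ for some $a\in F$; 3. $f$ right divides $t^n-a$ in $R$ for some $a\in F$, i.e. $t^n-a=gf$ for some $g\in R$. Moreover, the constants in (2) and (3) agree: for every $a\in F$, $\hat h(x)=x-a$ if and only if $f$ right divides $t^n-a$ in $R$. -/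

import Mathlib

noncomputable section

universe u

/-- The action of `ℕ` on the field `K` by the powers of the automorphism `σ`. -/
@[reducible]
def sigmaAction {K : Type u} [Field K] (σ : K ≃+* K) :
    MulSemiringAction (Multiplicative ℕ) K :=
  MulSemiringAction.compHom K (powersHom (K ≃+* K) σ)

/-- The twisted polynomial ring `K[t;σ]`: skew polynomials `∑ aᵢ tⁱ` with coefficients on the
left, multiplied by the rule `t a = σ(a) t` (see `TwistedPolynomial.t_mul_C`). -/
def TwistedPolynomial {K : Type u} [Field K] (_σ : K ≃+* K) : Type u :=
  SkewPolynomial K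

/-- The fixed field `F = Fix(σ)`. -/
abbrev fixedSubfield {K : Type u} [Field K] (σ : K ≃+* K) : Subfield K :=
  RingHom.eqLocusField (σ : K →+* K) (RingHom.id K)

namespace TwistedPolynomial

variable {K : Type u} [Field K] {σ : K ≃+* K}

instance : Ring (TwistedPolynomial σ) :=
  letI := sigmaAction σ
  inferInstanceAs (Ring (SkewPolynomial K))

/-- The embedding of `K` in `K[t;σ]` as constant polynomials. -/
def C : K →+* TwistedPolynomial σ :=
  letI := sigmaAction σ
  SkewPolynomial.CRingHom

/-- The indeterminate `t`. -/
def t : TwistedPolynomial σ :=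
  (SkewPolynomial.X : SkewPolynomial K)

/-- The degree, with `deg 0 = ⊥`. -/
def degree (f : TwistedPolynomial σ) : WithBot ℕ :=
  (SkewPolynomial.support (R := K) f).max

/-- The defining relation of `K[t;σ]`. -/
theorem t_mul_C (a : K) : (t : TwistedPolynomial σ) * C a = C (σ a) * t := by
  let _ := sigmaAction σ
  have h1 : (SkewPolynomial.X : SkewPolynomial K) * SkewPolynomial.C a
      = SkewPolynomial.monomial 1 (σ a) := by
    rw [SkewPolynomial.X, ← SkewPolynomial.monomial_zero_left,
      SkewPolynomial.monomial_mul_monomial]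
    simp only [add_zero, Function.iterate_one, one_mul]
    rfl
  have h2 : SkewPolynomial.C (σ a) * (SkewPolynomial.X : SkewPolynomial K)
      = SkewPolynomial.monomial 1 (σ a) := SkewPolynomial.C_mul_X_eq_monomial
  exact h1.trans h2.symm

/-- The constants from the fixed field are central. -/
theorem C_comm (a : fixedSubfield σ) (f : TwistedPolynomial σ) :
    C (a : K) * f = f * C (a : K) := by
  let _ := sigmaAction σ
  have ha : ∀ k : ℕ, (SkewPolynomial.φ (R := K))^[k] (a : K) = a := fun k =>
    Function.iterate_fixed (f := SkewPolynomial.φ (R := K)) a.2 k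
  have key : ∀ p : SkewPolynomial K,
      SkewPolynomial.C (a : K) * p = p * SkewPolynomial.C (a : K) := fun p => by
    induction p using SkewPolynomial.induction with
    | h0 => rw [mul_zero, zero_mul]
    | ha k r q _ _ ih =>
      rw [mul_add, add_mul, ih, SkewPolynomial.C_mul_monomial, SkewPolynomial.monomial_mul_C, ha,
        mul_comm]
  exact key f

/-- `K[t;σ]` is an algebra over the fixed field `F` of `σ`. -/
instance : Algebra (fixedSubfield σ) (TwistedPolynomial σ) :=
  RingHom.toAlgebra' (C.comp (fixedSubfield σ).subtype) C_comm

/-- `f` right divides `h`: `h = g f` for some `g`. -/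
def RightDvd (f h : TwistedPolynomial σ) : Prop :=
  ∃ g : TwistedPolynomial σ, h = g * f

/-- `d` is a greatest common right divisor of `f` and `g`. -/
def IsGCRD (f g d : TwistedPolynomial σ) : Prop :=
  RightDvd d f ∧ RightDvd d g ∧
    ∀ e : TwistedPolynomial σ, RightDvd e f → RightDvd e g → RightDvd e d

/-- `h` is the minimal central left multiple of `f`, where `h(t) = ĥ(tⁿ)` with `ĥ ∈ F[x]` monic:
`h` has minimal degree among the nonzero central left multiples of `f`. -/
structure IsMinimalCentralLeftMultiple (n : ℕ) (f h : TwistedPolynomial σ)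
    (hhat : Polynomial (fixedSubfield σ)) : Prop where
  central : h ∈ Subring.center (TwistedPolynomial σ)
  rightDvd : RightDvd f h
  monic : hhat.Monic
  eq_aeval : h = Polynomial.aeval (t ^ n) hhat
  minimal : ∀ h' ∈ Subring.center (TwistedPolynomial σ), h' ≠ 0 → RightDvd f h' →
    h.degree ≤ h'.degree

/-- The left idealiser `I(f) = {g | f g ∈ R f}` of `f` in `R = K[t;σ]`; `Ideal.span {f}` is the
left ideal `R f`. -/
def idealiser (f : TwistedPolynomial σ) :
    Subalgebra (fixedSubfield σ) (TwistedPolynomial σ) where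
  carrier := {g | f * g ∈ Ideal.span {f}}
  mul_mem' {a b} ha hb := by
    obtain ⟨c, hc⟩ := Ideal.mem_span_singleton'.1 ha
    change f * (a * b) ∈ Ideal.span {f}
    rw [← mul_assoc, ← hc, mul_assoc]
    exact Ideal.mul_mem_left _ c hb
  add_mem' {a b} ha hb := by
    change f * (a + b) ∈ Ideal.span {f}
    rw [mul_add]
    exact Ideal.add_mem _ ha hb
  algebraMap_mem' a := by
    change f * algebraMap _ _ a ∈ Ideal.span {f}
    rw [← Algebra.commutes]
    exact Ideal.mul_mem_left _ _ (Ideal.mem_span_singleton_self f)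

/-- The left ideal `R f`, regarded as an ideal of the idealiser `I(f)`. -/
def idealiserIdeal (f : TwistedPolynomial σ) : Ideal (idealiser f) :=
  (Ideal.span {f}).comap (idealiser f).val

instance (f : TwistedPolynomial σ) : (idealiserIdeal f).IsTwoSided where
  mul_mem_of_left {a} b ha := by
    change (a : TwistedPolynomial σ) ∈ Ideal.span {f} at ha
    obtain ⟨c, hc⟩ := Ideal.mem_span_singleton'.1 ha
    change (a : TwistedPolynomial σ) * (b : TwistedPolynomial σ) ∈ Ideal.span {f}
    rw [← hc, mul_assoc]
    exact Ideal.mul_mem_left _ c b.2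

/-- The eigenring `E(f) = I(f) / R f`, an algebra over `F`. -/
def Eigenring (f : TwistedPolynomial σ) : Type u :=
  idealiser f ⧸ idealiserIdeal f

instance (f : TwistedPolynomial σ) : Ring (Eigenring f) :=
  inferInstanceAs (Ring (idealiser f ⧸ idealiserIdeal f))

instance (f : TwistedPolynomial σ) : Algebra (fixedSubfield σ) (Eigenring f) :=
  inferInstanceAs (Algebra (fixedSubfield σ) (idealiser f ⧸ idealiserIdeal f))

/-- `f` is a generalised A-polynomial: `E(f)` is a (finite-dimensional) central simple algebra
over `F`. -/
structure IsGeneralisedAPolynomial (f : TwistedPolynomial σ) : Prop where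
  central : Algebra.IsCentral (fixedSubfield σ) (Eigenring f)
  simple : IsSimpleRing (Eigenring f)
  finite : FiniteDimensional (fixedSubfield σ) (Eigenring f)

end TwistedPolynomial

end

/-!
Let `n` be the order of `σ`. Since `tⁿ` is central in `R = K[t;σ]`, it acts on a central eigenring
`E(f)` as a scalar `a ∈ F`, which says that `f` right divides `tⁿ - a`.

Conversely, suppose that `f` right divides `tⁿ - a`. Here `a ≠ 0`, because `f` is coprime to `t`.
The cyclic algebra `A = R / R (tⁿ - a)` is then central simple over `F`: the image of `t` is a
unit, so by Dedekind's independence of the characters `1, σ, …, σⁿ⁻¹` a relation `∑ cᵢ tⁱ = 0` in a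
nonzero quotient of `A` is trivial. As `A` is semisimple, `R f / R (tⁿ - a)` is the left
annihilator of an idempotent `e`, and `g ↦ g e` identifies `E(f)` with the corner `e A e`. A nonzero
corner of a central simple algebra is central simple.

Finally, if `f` right divides both `ĥ(tⁿ)` and `tⁿ - a`, it right divides the constant `ĥ(a)`, so
`x - a` divides `ĥ`; minimality of the degree of `ĥ(tⁿ)` then leaves only `ĥ = x - a`.
-/

section Corner

variable {k A : Type*}

theorem exists_sum_mul_mul_eq_of_mem_span [Ring A] {x y : A} (hy : y ∈ TwoSidedIdeal.span {x}) :
    ∃ (ι : Type) (_ : Fintype ι) (a b : ι → A), ∑ i, a i * x * b i = y := by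
  rw [TwoSidedIdeal.mem_span_iff_mem_addSubgroup_closure] at hy
  induction hy using AddSubgroup.closure_induction with
  | mem y hy =>
    obtain ⟨_, ⟨a, -, _, rfl, rfl⟩, b, -, rfl⟩ := hy
    exact ⟨Unit, inferInstance, fun _ => a, fun _ => b, by simp⟩
  | zero => exact ⟨Empty, inferInstance, Empty.elim, Empty.elim, by simp⟩
  | add y z _ _ hy hz =>
    obtain ⟨ι, _, a, b, rfl⟩ := hy
    obtain ⟨κ, _, c, d, rfl⟩ := hz
    exact ⟨ι ⊕ κ, inferInstance, Sum.elim a c, Sum.elim b d, by simp⟩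
  | neg y _ hy =>
    obtain ⟨ι, _, a, b, rfl⟩ := hy
    exact ⟨ι, inferInstance, -a, b, by simp⟩

theorem exists_sum_mul_mul_eq_one [Ring A] [IsSimpleRing A] {x : A} (hx : x ≠ 0) :
    ∃ (ι : Type) (_ : Fintype ι) (a b : ι → A), ∑ i, a i * x * b i = 1 :=
  exists_sum_mul_mul_eq_of_mem_span <|
    IsSimpleRing.one_mem_of_ne_zero_mem _ hx (TwoSidedIdeal.subset_span rfl)

section Ring

variable [Ring A] {e : A} (he : IsIdempotentElem e)

theorem isSimpleRing_corner [IsSimpleRing A] (he0 : e ≠ 0) : IsSimpleRing he.Corner := by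
  have : Nontrivial he.Corner := ⟨1, 0, fun h => he0 (congrArg Subtype.val h)⟩
  refine .of_eq_bot_or_eq_top fun I => or_iff_not_imp_left.2 fun hI => ?_
  obtain ⟨x, hxI, hx0 : x ≠ 0⟩ := SetLike.exists_of_lt (bot_lt_iff_ne_bot.2 hI : ⊥ < I)
  obtain ⟨hex, hxe⟩ := (Subsemigroup.mem_corner_iff he).1 x.2
  obtain ⟨ι, _, a, b, hab⟩ := exists_sum_mul_mul_eq_one (x := x.1) fun h => hx0 (Subtype.ext h)
  let c (y : A) : he.Corner := ⟨e * y * e, y, rfl⟩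
  have hsum : ∑ i, c (a i) * x * c (b i) = 1 := by
    let val : he.Corner →+ A := (NonUnitalRing.corner e).subtype
    refine Subtype.ext (?_ : val _ = e)
    calc val (∑ i, c (a i) * x * c (b i)) = ∑ i, e * (a i * x.1 * b i) * e := by
          rw [map_sum]
          refine Finset.sum_congr rfl fun i _ => ?_
          calc e * a i * e * x.1 * (e * b i * e)
              = e * a i * (e * x.1 * e) * b i * e := by noncomm_ring
            _ = e * (a i * x.1 * b i) * e := by rw [hex, hxe]; noncomm_ring
      _ = e := by rw [← Finset.sum_mul, ← Finset.mul_sum, hab, mul_one, he.eq]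
  rw [← I.one_mem_iff, ← hsum]
  exact sum_mem fun i _ => I.mul_mem_right _ _ (I.mul_mem_left _ _ hxI)

theorem exists_mem_center_mul_eq [IsSimpleRing A] (he0 : e ≠ 0) {w : he.Corner}
    (hw : w ∈ Subring.center he.Corner) : ∃ z ∈ Subring.center A, z * e = w.1 := by
  obtain ⟨ι, _, a, b, hab⟩ := exists_sum_mul_mul_eq_one he0
  obtain ⟨hew, hwe⟩ := (Subsemigroup.mem_corner_iff he).1 w.2
  have hcomm (y : A) : w.1 * y * e = e * y * w.1 := by
    have h : e * y * e * w.1 = w.1 * (e * y * e) :=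
      congrArg Subtype.val (Subring.mem_center_iff.1 hw ⟨e * y * e, y, rfl⟩)
    calc w.1 * y * e = w.1 * e * y * e := by rw [hwe]
      _ = w.1 * (e * y * e) := by noncomm_ring
      _ = e * y * (e * w.1) := by rw [← h, mul_assoc (e * y)]
      _ = e * y * w.1 := by rw [hew]
  -- `w` is to be `z * e`, which forces `z = ∑ i, a i * (z * e) * b i = ∑ i, a i * w * b i`.
  refine ⟨∑ i, a i * w.1 * b i, Subring.mem_center_iff.2 fun c => ?_, ?_⟩
  · calc c * ∑ j, a j * w.1 * b j = (∑ i, a i * e * b i) * (c * ∑ j, a j * w.1 * b j) := by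
          rw [hab, one_mul]
      _ = ∑ i, ∑ j, a i * (e * (b i * c * a j) * w.1) * b j := by
          rw [Finset.mul_sum, Finset.sum_mul_sum]
          simp only [mul_assoc]
      _ = ∑ i, ∑ j, a i * (w.1 * (b i * c * a j) * e) * b j := by simp only [hcomm]
      _ = (∑ i, a i * w.1 * b i) * c * ∑ j, a j * e * b j := by
          rw [Finset.sum_mul, Finset.sum_mul_sum]
          simp only [mul_assoc]
      _ = (∑ i, a i * w.1 * b i) * c := by rw [hab, mul_one]
  · calc (∑ i, a i * w.1 * b i) * e = ∑ i, a i * (w.1 * b i * e) := by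
          simp only [Finset.sum_mul, mul_assoc]
      _ = (∑ i, a i * e * b i) * w.1 := by simp only [hcomm, Finset.sum_mul, mul_assoc]
      _ = w.1 := by rw [hab, one_mul]

end Ring

/-- The corner `eAe` as an algebra over `k`; its unit is `e`, so `c` acts as `c • e`. -/
instance [CommSemiring k] [Semiring A] [Algebra k A] {e : A} (he : IsIdempotentElem e) :
    Algebra k he.Corner where
  smul c x := ⟨c • x.1, by
    obtain ⟨hex, hxe⟩ := (Subsemigroup.mem_corner_iff he).1 x.2
    rw [Subsemigroup.mem_corner_iff he, mul_smul_comm, smul_mul_assoc, hex, hxe]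
    exact ⟨rfl, rfl⟩⟩
  algebraMap :=
    { toFun c := ⟨c • e, by
        rw [Subsemigroup.mem_corner_iff he, mul_smul_comm, smul_mul_assoc, he.eq]
        exact ⟨rfl, rfl⟩⟩
      map_one' := Subtype.ext (one_smul k e)
      map_mul' c d := Subtype.ext <| by
        change (c * d) • e = (c • e) * (d • e)
        rw [smul_mul_smul_comm, he.eq]
      map_zero' := Subtype.ext (zero_smul k e)
      map_add' c d := Subtype.ext (add_smul c d e) }
  commutes' c x := Subtype.ext <| by
    obtain ⟨hex, hxe⟩ := (Subsemigroup.mem_corner_iff he).1 x.2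
    change (c • e) * x.1 = x.1 * (c • e)
    rw [smul_mul_assoc, mul_smul_comm, hex, hxe]
  smul_def' c x := Subtype.ext <| by
    change c • x.1 = (c • e) * x.1
    rw [smul_mul_assoc, ((Subsemigroup.mem_corner_iff he).1 x.2).1]

theorem isCentral_corner [CommSemiring k] [Ring A] [Algebra k A] [Algebra.IsCentral k A]
    [IsSimpleRing A] {e : A} (he : IsIdempotentElem e) (he0 : e ≠ 0) :
    Algebra.IsCentral k he.Corner where
  out w hw := by
    obtain ⟨z, hz, hzw⟩ := exists_mem_center_mul_eq he he0 hw
    obtain ⟨c, rfl⟩ := (Algebra.IsCentral.mem_center_iff k).1 hz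
    exact Algebra.mem_bot.2 ⟨c, Subtype.ext ((Algebra.smul_def c e).trans hzw)⟩

theorem finite_corner [CommSemiring k] [Semiring A] [Algebra k A] [Module.Finite k A] {e : A}
    (he : IsIdempotentElem e) : Module.Finite k he.Corner :=
  let compress : A →ₗ[k] he.Corner :=
    { toFun y := ⟨e * y * e, y, rfl⟩
      map_add' y z := Subtype.ext <| by
        change e * (y + z) * e = e * y * e + e * z * e
        rw [mul_add, add_mul]
      map_smul' c y := Subtype.ext <| by
        change e * (c • y) * e = c • (e * y * e)
        rw [mul_smul_comm, smul_mul_assoc] }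
  .of_surjective compress fun ⟨_, y, hy⟩ => ⟨y, Subtype.ext hy⟩

end Corner

theorem exists_isIdempotentElem_mem_iff_mul_eq_zero {R A : Type*} [Ring R] [Ring A]
    [IsSemisimpleRing A] {q : R →+* A} (hq : Function.Surjective q) {J : Ideal R}
    (hJ : RingHom.ker q ≤ J) :
    ∃ e, IsIdempotentElem e ∧ ∀ p, p ∈ J ↔ q p * e = 0 := by
  obtain ⟨ε, hε, hspan⟩ := IsSemisimpleRing.ideal_eq_span_idempotent (J.map q)
  refine ⟨1 - ε, hε.one_sub, fun p => ?_⟩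
  calc p ∈ J ↔ q p ∈ J.map q := by
        rw [← Ideal.mem_comap, Ideal.comap_map_of_surjective' q hq, sup_eq_left.2 hJ]
    _ ↔ q p * (1 - ε) = 0 := by
        rw [hspan, Ideal.mem_span_singleton', mul_sub, mul_one, sub_eq_zero]
        refine ⟨?_, fun h => ⟨q p, h.symm⟩⟩
        rintro ⟨a, ha⟩
        rw [← ha, mul_assoc, hε.eq]

-- Evaluating linear functionals on `(∑ i, v i) * C x = 0` reduces this to Dedekind's independence
-- of characters.
theorem eq_zero_of_sum_eq_zero_of_semiconj {K B ι : Type*} [Field K] [Ring B] [Fintype ι]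
    (C : K →+* B) {χ : ι → K →* K} (hχ : Function.Injective χ) {v : ι → B}
    (hv : ∀ i x, v i * C x = C (χ i x) * v i) (hsum : ∑ i, v i = 0) (i : ι) : v i = 0 := by
  let := C.toModule
  have hli : LinearIndependent K fun i => (χ i : K → K) :=
    (linearIndependent_monoidHom K K).comp χ hχ
  refine (Module.forall_dual_apply_eq_zero_iff K (v i)).1 fun φ => ?_
  refine Fintype.linearIndependent_iff.1 hli (fun i => φ (v i)) (funext fun x => ?_) i
  calc (∑ i, φ (v i) • (χ i : K → K)) x = φ (∑ i, C (χ i x) * v i) := by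
        rw [map_sum, Finset.sum_apply]
        exact Finset.sum_congr rfl fun i _ =>
          (mul_comm _ _).trans (φ.map_smul (χ i x) (v i)).symm
    _ = φ ((∑ i, v i) * C x) := by simp only [hv, Finset.sum_mul]
    _ = 0 := by rw [hsum, zero_mul, map_zero]

namespace TwistedPolynomial

variable {K : Type*} [Field K] {σ : K ≃+* K}

section Coeff

theorem monomial_eq_C_mul_t_pow (k : ℕ) (r : K) :
    (SkewPolynomial.monomial k r : SkewPolynomial K) = (C r * t ^ k : TwistedPolynomial σ) := by
  let _ := sigmaAction σ
  exact (SkewPolynomial.C_mul_X_pow_eq_monomial (R := K) (a := r) (n := k)).symm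

theorem induction_on {motive : TwistedPolynomial σ → Prop} (p : TwistedPolynomial σ)
    (zero : motive 0) (add : ∀ p q, motive p → motive q → motive (p + q))
    (monomial : ∀ r k, motive (C r * t ^ k)) : motive p := by
  let _ := sigmaAction σ
  refine SkewPolynomial.induction (R := K) (motive := motive) p zero fun k r q _ _ hq => ?_
  exact add _ _ (monomial_eq_C_mul_t_pow (σ := σ) k r ▸ monomial r k) hq

/-- The coefficient of `t ^ k`, the coefficients being written on the left of the powers of `t`. -/
def coeff (k : ℕ) : TwistedPolynomial σ →+ K where
  toFun p := SkewPolynomial.coeff (R := K) p k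
  map_zero' := rfl
  map_add' p q := SkewPolynomial.coeff_add (R := K) p q k

theorem coeff_C_mul_t_pow (a : K) (j k : ℕ) :
    coeff k (C a * t ^ j : TwistedPolynomial σ) = if j = k then a else 0 := by
  rw [← monomial_eq_C_mul_t_pow]
  exact SkewPolynomial.coeff_monomial

theorem coeff_t_pow (j k : ℕ) :
    coeff k (t ^ j : TwistedPolynomial σ) = if j = k then 1 else 0 := by
  simpa only [map_one, one_mul] using coeff_C_mul_t_pow (σ := σ) 1 j k

theorem coeff_C (a : K) (k : ℕ) :
    coeff k (C a : TwistedPolynomial σ) = if 0 = k then a else 0 := by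
  simpa only [pow_zero, mul_one] using coeff_C_mul_t_pow (σ := σ) a 0 k

theorem coeff_mul (p q : TwistedPolynomial σ) (k : ℕ) :
    coeff k (p * q) = ∑ ij ∈ Finset.HasAntidiagonal.antidiagonal k,
      coeff ij.1 p * (σ ^ ij.1) (coeff ij.2 q) := by
  let _ := sigmaAction σ
  let S : Finset (Multiplicative ℕ × Multiplicative ℕ) :=
    (Finset.HasAntidiagonal.antidiagonal k).map
      (Equiv.prodCongr Multiplicative.ofAdd Multiplicative.ofAdd).toEmbedding
  refine (SkewMonoidAlgebra.coeff_mul_antidiagonal_of_finset (k := K) p q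
    (Multiplicative.ofAdd k) S fun {ij} => ?_).trans (Finset.sum_map _ _ _)
  rw [Finset.mem_map_equiv, Finset.HasAntidiagonal.mem_antidiagonal]
  exact Iff.rfl

theorem le_degree_of_coeff_ne_zero {p : TwistedPolynomial σ} {k : ℕ} (h : coeff k p ≠ 0) :
    k ≤ p.degree :=
  Finset.le_max (SkewPolynomial.mem_support_iff.2 h)

theorem degree_le_of_coeff_eq_zero {p : TwistedPolynomial σ} {d : ℕ}
    (h : ∀ k, d < k → coeff k p = 0) : p.degree ≤ d :=
  Finset.max_le fun k hk => by
    by_contra! hdk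
    exact SkewPolynomial.mem_support_iff.1 hk (h k (WithBot.coe_lt_coe.1 hdk))

theorem exists_degree_eq {p : TwistedPolynomial σ} (hp : p ≠ 0) :
    ∃ d : ℕ, p.degree = d ∧ coeff d p ≠ 0 := by
  have hsupp : (SkewPolynomial.support (R := K) p).Nonempty :=
    Finset.nonempty_iff_ne_empty.2 (mt SkewPolynomial.support_eq_empty.1 hp)
  obtain ⟨d, hd⟩ := Finset.max_of_nonempty hsupp
  exact ⟨d, hd, SkewPolynomial.mem_support_iff.1 (Finset.mem_of_max hd)⟩

theorem coeff_eq_zero_of_degree_lt {p : TwistedPolynomial σ} {k : ℕ} (h : p.degree < k) :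
    coeff k p = 0 :=
  not_not.1 fun hk => h.not_ge (le_degree_of_coeff_ne_zero hk)

theorem coeff_add_mul_of_degree_le {p q : TwistedPolynomial σ} {i j : ℕ} (hp : p.degree ≤ i)
    (hq : q.degree ≤ j) : coeff (i + j) (p * q) = coeff i p * (σ ^ i) (coeff j q) := by
  rw [coeff_mul]
  refine Finset.sum_eq_single_of_mem (i, j) (Finset.HasAntidiagonal.mem_antidiagonal.2 rfl) ?_
  rintro ⟨i', j'⟩ hij hne
  rw [Finset.HasAntidiagonal.mem_antidiagonal] at hij
  obtain hi | hj : i < i' ∨ j < j' := by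
    contrapose! hne
    exact Prod.ext (by simp only at hij; omega) (by simp only at hij; omega)
  · rw [coeff_eq_zero_of_degree_lt (hp.trans_lt (WithBot.coe_lt_coe.2 hi)), zero_mul]
  · rw [coeff_eq_zero_of_degree_lt (hq.trans_lt (WithBot.coe_lt_coe.2 hj)), map_zero, mul_zero]

theorem RightDvd.degree_le {f h : TwistedPolynomial σ} (hdvd : RightDvd f h) (hh : h ≠ 0) :
    f.degree ≤ h.degree := by
  obtain ⟨g, rfl⟩ := hdvd
  obtain ⟨i, hi, hgi⟩ := exists_degree_eq (left_ne_zero_of_mul hh)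
  obtain ⟨j, hj, hfj⟩ := exists_degree_eq (right_ne_zero_of_mul hh)
  have hlead : coeff (i + j) (g * f) ≠ 0 := by
    rw [coeff_add_mul_of_degree_le hi.le hj.le]
    exact mul_ne_zero hgi ((map_ne_zero (σ ^ i)).2 hfj)
  calc f.degree = j := hj
    _ ≤ (i + j : ℕ) := WithBot.coe_le_coe.2 (Nat.le_add_left j i)
    _ ≤ (g * f).degree := le_degree_of_coeff_ne_zero hlead

theorem not_rightDvd_C {f : TwistedPolynomial σ} (hf : 1 ≤ f.degree) {c : K} (hc : c ≠ 0) :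
    ¬ RightDvd f (C c) := by
  intro hdvd
  have hC : (C c : TwistedPolynomial σ).degree ≤ (0 : ℕ) :=
    degree_le_of_coeff_eq_zero fun k hk => by rw [coeff_C, if_neg hk.ne]
  have hle := hf.trans ((hdvd.degree_le (fun h => hc ?_)).trans hC)
  · exact absurd hle (by decide)
  · simpa using (coeff_C c 0).symm.trans (congrArg (coeff 0) h)

theorem one_le_degree_t : 1 ≤ (t : TwistedPolynomial σ).degree :=
  le_degree_of_coeff_ne_zero (k := 1) <| by
    rw [← pow_one t, coeff_t_pow, if_pos rfl]
    exact one_ne_zero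

theorem degree_t_pow_sub_C {n : ℕ} (hn : 0 < n) (a : K) :
    (t ^ n - C a : TwistedPolynomial σ).degree = n := by
  refine le_antisymm (degree_le_of_coeff_eq_zero fun k hk => ?_) (le_degree_of_coeff_ne_zero ?_)
  · rw [map_sub, coeff_t_pow, coeff_C, if_neg hk.ne, if_neg (by omega), sub_zero]
  · rw [map_sub, coeff_t_pow, coeff_C, if_pos rfl, if_neg hn.ne, sub_zero]
    exact one_ne_zero

theorem t_pow_sub_C_ne_zero {n : ℕ} (hn : 0 < n) (a : K) :
    (t ^ n - C a : TwistedPolynomial σ) ≠ 0 := fun h => by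
  have hdegree := degree_t_pow_sub_C (σ := σ) hn a
  rw [h] at hdegree
  exact WithBot.bot_ne_coe hdegree

theorem algebraMap_eq_C (a : fixedSubfield σ) :
    algebraMap (fixedSubfield σ) (TwistedPolynomial σ) a = C (a : K) :=
  rfl

theorem smul_eq_C_mul (a : fixedSubfield σ) (p : TwistedPolynomial σ) :
    a • p = C (a : K) * p :=
  Algebra.smul_def a p

theorem natDegree_mul_le_degree_aeval_t_pow {n : ℕ} (hn : 0 < n)
    {q : Polynomial (fixedSubfield σ)} (hq : q ≠ 0) :
    (q.natDegree * n : ℕ) ≤ (Polynomial.aeval (t ^ n : TwistedPolynomial σ) q).degree := by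
  refine le_degree_of_coeff_ne_zero ?_
  have hlead : coeff (q.natDegree * n) (Polynomial.aeval (t ^ n : TwistedPolynomial σ) q) =
      q.leadingCoeff := by
    rw [Polynomial.aeval_eq_sum_range, map_sum]
    simp only [smul_eq_C_mul, ← pow_mul, mul_comm n, coeff_C_mul_t_pow, Nat.mul_left_inj hn.ne']
    rw [Finset.sum_ite_eq', if_pos (Finset.self_mem_range_succ _)]
    rfl
  rw [hlead]
  exact_mod_cast Polynomial.leadingCoeff_ne_zero.2 hq

end Coeff

section TwistedRelation

theorem t_pow_mul_C (k : ℕ) (x : K) :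
    (t : TwistedPolynomial σ) ^ k * C x = C ((σ ^ k) x) * t ^ k := by
  induction k generalizing x with
  | zero => simp
  | succ k ih => rw [pow_succ, mul_assoc, t_mul_C, ← mul_assoc, ih, mul_assoc, pow_succ,
      RingAut.mul_apply]

theorem commute_t_pow_orderOf (p : TwistedPolynomial σ) : Commute (t ^ orderOf σ) p := by
  induction p using induction_on with
  | zero => exact Commute.zero_right _
  | add p q hp hq => exact hp.add_right hq
  | monomial r k =>
    refine Commute.mul_right ?_ (Commute.pow_pow_self t _ _)
    rw [commute_iff_eq, t_pow_mul_C, pow_orderOf_eq_one, RingAut.one_apply]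

theorem t_pow_orderOf_sub_C_mem_center (a : fixedSubfield σ) :
    (t ^ orderOf σ - C (a : K) : TwistedPolynomial σ) ∈ Subring.center (TwistedPolynomial σ) :=
  Subring.mem_center_iff.2 fun p => by
    rw [mul_sub, sub_mul, (commute_t_pow_orderOf p).eq, C_comm]

theorem rightDvd_iff_mem_span {f h : TwistedPolynomial σ} :
    RightDvd f h ↔ h ∈ Ideal.span {f} := by
  rw [Ideal.mem_span_singleton']
  exact exists_congr fun _ => eq_comm

theorem exists_t_pow_mul_eq_mul_t_pow (k : ℕ) (p : TwistedPolynomial σ) :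
    ∃ q, t ^ k * p = q * t ^ k := by
  induction p using induction_on with
  | zero => exact ⟨0, by rw [mul_zero, zero_mul]⟩
  | add p q hp hq =>
    obtain ⟨p', hp⟩ := hp
    obtain ⟨q', hq⟩ := hq
    exact ⟨p' + q', by rw [mul_add, add_mul, hp, hq]⟩
  | monomial r j =>
    exact ⟨C ((σ ^ k) r) * t ^ j, by
      rw [← mul_assoc, t_pow_mul_C, mul_assoc, mul_assoc, ← pow_add, ← pow_add, add_comm]⟩

end TwistedRelation

section CoprimeToT

theorem exists_eq_mul_t_add_C (f : TwistedPolynomial σ) : ∃ g c, f = g * t + C c := by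
  induction f using induction_on with
  | zero => exact ⟨0, 0, by simp⟩
  | add p q hp hq =>
    obtain ⟨p', c, rfl⟩ := hp
    obtain ⟨q', d, rfl⟩ := hq
    exact ⟨p' + q', c + d, by rw [map_add]; noncomm_ring⟩
  | monomial r k =>
    cases k with
    | zero => exact ⟨0, r, by simp⟩
    | succ k => exact ⟨C r * t ^ k, 0, by simp [pow_succ, mul_assoc]⟩

theorem IsGCRD.exists_mul_add_mul_t_eq_one {f : TwistedPolynomial σ} (hgcrd : IsGCRD f t 1) :
    ∃ u v, u * f + v * t = 1 := by
  obtain ⟨g, c, rfl⟩ := exists_eq_mul_t_add_C f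
  have hc : c ≠ 0 := by
    rintro rfl
    have ht : RightDvd t (C 1 : TwistedPolynomial σ) := by
      rw [map_one]
      exact hgcrd.2.2 t ⟨g, by rw [map_zero, add_zero]⟩ ⟨1, (one_mul t).symm⟩
    exact not_rightDvd_C one_le_degree_t one_ne_zero ht
  refine ⟨C c⁻¹, -(C c⁻¹ * g), ?_⟩
  calc C c⁻¹ * (g * t + C c) + -(C c⁻¹ * g) * t = C c⁻¹ * C c := by noncomm_ring
    _ = 1 := by rw [← map_mul, inv_mul_cancel₀ hc, map_one]

theorem IsGCRD.rightDvd_t_pow_of_succ {f : TwistedPolynomial σ} (hgcrd : IsGCRD f t 1) {k : ℕ}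
    (hdvd : RightDvd f (t ^ (k + 1))) : RightDvd f (t ^ k) := by
  obtain ⟨u, v, huv⟩ := hgcrd.exists_mul_add_mul_t_eq_one
  obtain ⟨w, hw⟩ := exists_t_pow_mul_eq_mul_t_pow k v
  obtain ⟨g, hg⟩ := hdvd
  refine ⟨t ^ k * u + w * g, ?_⟩
  calc t ^ k = t ^ k * (u * f + v * t) := by rw [huv, mul_one]
    _ = t ^ k * u * f + t ^ k * v * t := by noncomm_ring
    _ = t ^ k * u * f + w * t ^ (k + 1) := by rw [hw, mul_assoc w, pow_succ]
    _ = (t ^ k * u + w * g) * f := by rw [hg]; noncomm_ring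

theorem IsGCRD.not_rightDvd_t_pow {f : TwistedPolynomial σ} (hgcrd : IsGCRD f t 1)
    (hf : 1 ≤ f.degree) (k : ℕ) : ¬ RightDvd f (t ^ k) := by
  induction k with
  | zero => simpa only [pow_zero, map_one] using not_rightDvd_C hf one_ne_zero
  | succ k ih => exact fun hdvd => ih (hgcrd.rightDvd_t_pow_of_succ hdvd)

end CoprimeToT

section CyclicAlgebra

theorem finiteDimensional_fixedSubfield (hσ : IsOfFinOrder σ) :
    FiniteDimensional (fixedSubfield σ) K := by
  have : Finite (Subgroup.zpowers σ) := hσ.finite_zpowers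
  have hfix : fixedSubfield σ = FixedPoints.subfield (Subgroup.zpowers σ) K := by
    ext x
    refine ⟨fun hx => ?_, fun hx => hx ⟨σ, Subgroup.mem_zpowers σ⟩⟩
    have h : σ ∈ MulAction.stabilizer (K ≃+* K) x := hx
    exact fun g => Subgroup.zpowers_le.2 h g.2
  rw [hfix]
  infer_instance

instance isTwoSided_span_t_pow_orderOf_sub_C (a : fixedSubfield σ) :
    (Ideal.span {(t ^ orderOf σ - C (a : K) : TwistedPolynomial σ)}).IsTwoSided where
  mul_mem_of_left {p} q hp := by
    obtain ⟨r, rfl⟩ := Ideal.mem_span_singleton'.1 hp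
    rw [mul_assoc, ← Subring.mem_center_iff.1 (t_pow_orderOf_sub_C_mem_center a) q, ← mul_assoc]
    exact Ideal.mul_mem_left _ _ (Ideal.mem_span_singleton_self _)

/-- The cyclic algebra `(K/F, σ, a)`, where `F` is the fixed field of `σ`, realised as the quotient
of `K[t;σ]` by the central element `t ^ n - a`, `n` being the order of `σ`. -/
abbrev CyclicAlgebra (σ : K ≃+* K) (a : fixedSubfield σ) : Type _ :=
  TwistedPolynomial σ ⧸ Ideal.span {(t ^ orderOf σ - C (a : K) : TwistedPolynomial σ)}

/-- The polynomial with given coefficients in degrees below the order of `σ`, as an `F`-linear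
function of its coefficients. -/
noncomputable def ofCoeffs : (Fin (orderOf σ) → K) →ₗ[fixedSubfield σ] TwistedPolynomial σ where
  toFun c := ∑ i, C (c i) * t ^ (i : ℕ)
  map_add' c d := by simp only [Pi.add_apply, map_add, add_mul, Finset.sum_add_distrib]
  map_smul' r c := by
    simp only [Pi.smul_apply, Subfield.smul_def, smul_eq_mul, map_mul, mul_assoc, smul_eq_C_mul,
      Finset.mul_sum, RingHom.id_apply]

theorem ofCoeffs_apply (c : Fin (orderOf σ) → K) :
    ofCoeffs c = ∑ i, (C (c i) * t ^ (i : ℕ) : TwistedPolynomial σ) :=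
  rfl

theorem ofCoeffs_single (i : Fin (orderOf σ)) (x : K) :
    ofCoeffs (Pi.single i x) = (C x * t ^ (i : ℕ) : TwistedPolynomial σ) := by
  rw [ofCoeffs_apply, Finset.sum_eq_single_of_mem i (Finset.mem_univ i), Pi.single_eq_same]
  intro j _ hj
  rw [Pi.single_eq_of_ne hj, map_zero, zero_mul]

theorem C_mul_ofCoeffs (x : K) (c : Fin (orderOf σ) → K) :
    (C x * ofCoeffs c : TwistedPolynomial σ) = ofCoeffs fun i => x * c i := by
  simp only [ofCoeffs_apply, Finset.mul_sum, map_mul, mul_assoc]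

theorem ofCoeffs_mul_C (x : K) (c : Fin (orderOf σ) → K) :
    (ofCoeffs c * C x : TwistedPolynomial σ) = ofCoeffs fun i => c i * (σ ^ (i : ℕ)) x := by
  simp only [ofCoeffs_apply, Finset.sum_mul, map_mul, mul_assoc, t_pow_mul_C]

theorem t_mul_ofCoeffs (c : Fin (orderOf σ) → K) :
    (t * ofCoeffs c : TwistedPolynomial σ) = ofCoeffs (fun i => σ (c i)) * t := by
  simp only [ofCoeffs_apply, Finset.mul_sum, Finset.sum_mul, mul_assoc, ← pow_succ]
  simp only [← mul_assoc, t_mul_C, pow_succ']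

theorem eq_zero_of_map_ofCoeffs_eq_zero {B : Type*} [Ring B] [Nontrivial B]
    {ψ : TwistedPolynomial σ →+* B} (ht : IsUnit (ψ t)) {c : Fin (orderOf σ) → K}
    (hc : ψ (ofCoeffs c) = 0) : c = 0 := by
  funext i
  let χ (i : Fin (orderOf σ)) : K →* K := ((σ ^ (i : ℕ) : K ≃+* K) : K →* K)
  have hχ : Function.Injective χ := fun i j hij =>
    Fin.ext <| pow_injOn_Iio_orderOf i.2 j.2 <| RingEquiv.ext fun x => DFunLike.congr_fun hij x
  have hmonomial : ψ (C (c i) * t ^ (i : ℕ)) = 0 := by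
    refine eq_zero_of_sum_eq_zero_of_semiconj (ψ.comp C) hχ
      (v := fun i => ψ (C (c i) * t ^ (i : ℕ))) (fun i x => ?_) ?_ i
    · change _ = ψ (C ((σ ^ (i : ℕ)) x)) * _
      rw [RingHom.comp_apply, ← map_mul, ← map_mul, mul_assoc, t_pow_mul_C, ← mul_assoc,
        ← mul_assoc, ← map_mul, ← map_mul, mul_comm]
    · rw [← map_sum]
      exact hc
  rw [map_mul, map_pow, (ht.pow _).mul_left_eq_zero] at hmonomial
  exact (map_eq_zero (ψ.comp C)).1 hmonomial

namespace CyclicAlgebra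

variable {a : fixedSubfield σ}

variable (a) in
/-- The quotient map `K[t;σ] → (K/F, σ, a)`. -/
noncomputable abbrev mk : TwistedPolynomial σ →ₐ[fixedSubfield σ] CyclicAlgebra σ a :=
  Ideal.Quotient.mkₐ (fixedSubfield σ) _

theorem mk_t_pow_orderOf : mk a (t ^ orderOf σ) = mk a (C (a : K)) :=
  Ideal.Quotient.eq.2 (Ideal.mem_span_singleton_self _)

theorem mk_ofCoeffs_surjective (hσ : IsOfFinOrder σ) :
    Function.Surjective fun c : Fin (orderOf σ) → K => mk a (ofCoeffs c) := by
  intro x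
  obtain ⟨p, rfl⟩ := Ideal.Quotient.mk_surjective x
  induction p using induction_on with
  | zero => exact ⟨0, by simp⟩
  | add p q hp hq =>
    obtain ⟨c, hc⟩ := hp
    obtain ⟨d, hd⟩ := hq
    exact ⟨c + d, by simpa only [map_add] using congrArg₂ (· + ·) hc hd⟩
  | monomial r k =>
    refine ⟨Pi.single ⟨k % orderOf σ, Nat.mod_lt k hσ.orderOf_pos⟩ (r * a ^ (k / orderOf σ)), ?_⟩
    change mk a (ofCoeffs _) = mk a (C r * t ^ k)
    rw [ofCoeffs_single]
    calc mk a (C (r * a ^ (k / orderOf σ)) * t ^ (k % orderOf σ))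
        = mk a (C r) * mk a (C (a : K)) ^ (k / orderOf σ) * mk a t ^ (k % orderOf σ) := by
          simp only [map_mul, map_pow]
      _ = mk a (C r * ((t ^ orderOf σ) ^ (k / orderOf σ) * t ^ (k % orderOf σ))) := by
          rw [← mk_t_pow_orderOf, ← map_pow, ← map_pow, ← map_mul, ← map_mul, mul_assoc]
      _ = mk a (C r * t ^ k) := by rw [← pow_mul, ← pow_add, Nat.div_add_mod]

theorem finiteDimensional (hσ : IsOfFinOrder σ) :
    FiniteDimensional (fixedSubfield σ) (CyclicAlgebra σ a) :=
  have := finiteDimensional_fixedSubfield hσ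
  Module.Finite.of_surjective ((mk a).toLinearMap ∘ₗ ofCoeffs) (mk_ofCoeffs_surjective hσ)

theorem nontrivial (hσ : IsOfFinOrder σ) : Nontrivial (CyclicAlgebra σ a) := by
  refine Ideal.Quotient.nontrivial_iff.2 fun htop => ?_
  have hdegree : 1 ≤ (t ^ orderOf σ - C (a : K) : TwistedPolynomial σ).degree := by
    rw [degree_t_pow_sub_C hσ.orderOf_pos]
    exact_mod_cast hσ.orderOf_pos
  refine not_rightDvd_C hdegree one_ne_zero (rightDvd_iff_mem_span.2 ?_)
  rw [htop]
  exact Submodule.mem_top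

theorem isUnit_mk_t (hσ : IsOfFinOrder σ) (ha : a ≠ 0) : IsUnit (mk a t) := by
  rw [← isUnit_pow_iff hσ.orderOf_pos.ne', ← map_pow, mk_t_pow_orderOf]
  exact (IsUnit.mk0 (a : K) (by exact_mod_cast ha)).map ((mk a).toRingHom.comp C)

theorem isSimpleRing (hσ : IsOfFinOrder σ) (ha : a ≠ 0) : IsSimpleRing (CyclicAlgebra σ a) := by
  refine isSimpleRing_iff_isTwoSided_imp.2
    ⟨nontrivial hσ, fun I _ => or_iff_not_imp_right.2 fun hI => ?_⟩
  have : Nontrivial (CyclicAlgebra σ a ⧸ I) := Ideal.Quotient.nontrivial_iff.2 hI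
  let ψ : TwistedPolynomial σ →+* CyclicAlgebra σ a ⧸ I := (Ideal.Quotient.mk I).comp (mk a)
  refine eq_bot_iff.2 fun x hx => ?_
  obtain ⟨c, rfl⟩ := mk_ofCoeffs_surjective hσ x
  have hc : c = 0 := eq_zero_of_map_ofCoeffs_eq_zero (ψ := ψ)
    ((isUnit_mk_t hσ ha).map (Ideal.Quotient.mk I)) (Ideal.Quotient.eq_zero_iff_mem.2 hx)
  simp [hc]

theorem eq_of_mk_ofCoeffs_eq (hσ : IsOfFinOrder σ) (ha : a ≠ 0) {c d : Fin (orderOf σ) → K}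
    (h : mk a (ofCoeffs c) = mk a (ofCoeffs d)) : c = d := by
  have := nontrivial (a := a) hσ
  refine sub_eq_zero.1 (eq_zero_of_map_ofCoeffs_eq_zero (ψ := (mk a).toRingHom)
    (isUnit_mk_t hσ ha) ?_)
  change mk a (ofCoeffs (c - d)) = 0
  rw [map_sub, map_sub, h, sub_self]

theorem map_eq_of_mk_ofCoeffs_mem_center (hσ : IsOfFinOrder σ) (ha : a ≠ 0)
    {c : Fin (orderOf σ) → K} (hc : mk a (ofCoeffs c) ∈ Subring.center (CyclicAlgebra σ a)) (i) :
    σ (c i) = c i := by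
  have hconj : mk a (ofCoeffs fun i => σ (c i)) = mk a (ofCoeffs c) := by
    rw [← (isUnit_mk_t hσ ha).mul_left_inj, ← map_mul, ← t_mul_ofCoeffs, map_mul,
      Subring.mem_center_iff.1 hc]
  exact congrFun (eq_of_mk_ofCoeffs_eq hσ ha hconj) i

theorem eq_zero_of_mk_ofCoeffs_mem_center (hσ : IsOfFinOrder σ) (ha : a ≠ 0)
    {c : Fin (orderOf σ) → K} (hc : mk a (ofCoeffs c) ∈ Subring.center (CyclicAlgebra σ a))
    {i : Fin (orderOf σ)} (hi : (i : ℕ) ≠ 0) : c i = 0 := by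
  by_contra hci
  refine pow_ne_one_of_lt_orderOf hi i.2 (RingEquiv.ext fun x => mul_left_cancel₀ hci ?_)
  have hcomm :
      mk a (ofCoeffs fun i => c i * (σ ^ (i : ℕ)) x) = mk a (ofCoeffs fun i => x * c i) := by
    rw [← ofCoeffs_mul_C, ← C_mul_ofCoeffs, map_mul, map_mul, Subring.mem_center_iff.1 hc]
  exact (congrFun (eq_of_mk_ofCoeffs_eq hσ ha hcomm) i).trans (mul_comm _ _)

theorem isCentral (hσ : IsOfFinOrder σ) (ha : a ≠ 0) :
    Algebra.IsCentral (fixedSubfield σ) (CyclicAlgebra σ a) where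
  out z hz := by
    obtain ⟨c, rfl⟩ := mk_ofCoeffs_surjective hσ z
    let i₀ : Fin (orderOf σ) := ⟨0, hσ.orderOf_pos⟩
    have hc : c = Pi.single i₀ (c i₀) := by
      funext i
      obtain rfl | hi := eq_or_ne i i₀
      · rw [Pi.single_eq_same]
      · rw [Pi.single_eq_of_ne hi]
        exact eq_zero_of_mk_ofCoeffs_mem_center hσ ha hz fun h => hi (Fin.ext h)
    refine Algebra.mem_bot.2 ⟨⟨c i₀, map_eq_of_mk_ofCoeffs_mem_center hσ ha hz i₀⟩, ?_⟩
    change mk a (C (c i₀)) = mk a (ofCoeffs c)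
    rw [hc, ofCoeffs_single, Pi.single_eq_same, pow_zero, mul_one]

end CyclicAlgebra

end CyclicAlgebra

section Eigenring

variable {f : TwistedPolynomial σ}

section Corner

variable {A : Type*} [Ring A] [Algebra (fixedSubfield σ) A]
  {q : TwistedPolynomial σ →ₐ[fixedSubfield σ] A}
  (hq : Function.Surjective q) {e : A} (he : IsIdempotentElem e)
  (hspan : ∀ p, p ∈ Ideal.span {f} ↔ q p * e = 0)

include hq he hspan

theorem mul_map_mul_eq_of_mem_idealiser {g : TwistedPolynomial σ} (hg : g ∈ idealiser f) :
    e * (q g * e) = q g * e := by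
  obtain ⟨p, hp⟩ := hq (1 - e)
  have hpf : p ∈ Ideal.span {f} := by rw [hspan, hp, sub_mul, one_mul, he.eq, sub_self]
  obtain ⟨r, rfl⟩ := Ideal.mem_span_singleton'.1 hpf
  have hrg : r * f * g ∈ Ideal.span {f} := by
    rw [mul_assoc]
    exact Ideal.mul_mem_left _ r hg
  rw [hspan, map_mul, hp, sub_mul, one_mul, sub_mul, mul_assoc, sub_eq_zero] at hrg
  exact hrg.symm

theorem nonempty_eigenring_algEquiv_corner :
    Nonempty (Eigenring f ≃ₐ[fixedSubfield σ] he.Corner) := by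
  have hcorner (g : idealiser f) : q g * e ∈ Subsemigroup.corner e :=
    (Subsemigroup.mem_corner_iff he).2
      ⟨mul_map_mul_eq_of_mem_idealiser hq he hspan g.2, by rw [mul_assoc, he.eq]⟩
  let φ : idealiser f →ₐ[fixedSubfield σ] he.Corner :=
    { toFun g := ⟨q g * e, hcorner g⟩
      map_one' := Subtype.ext <| by
        change q 1 * e = e
        rw [map_one, one_mul]
      map_mul' g h := Subtype.ext <| by
        change q (g * h) * e = q g * e * (q h * e)
        rw [mul_assoc (q g), mul_map_mul_eq_of_mem_idealiser hq he hspan h.2, map_mul, mul_assoc]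
      map_zero' := Subtype.ext <| by
        change q 0 * e = 0
        rw [map_zero, zero_mul]
      map_add' g h := Subtype.ext <| by
        change q (g + h) * e = q g * e + q h * e
        rw [map_add, add_mul]
      commutes' c := Subtype.ext <| by
        change q (algebraMap _ _ c) * e = c • e
        rw [AlgHom.commutes, Algebra.smul_def] }
  have hker : RingHom.ker φ = idealiserIdeal f := Ideal.ext fun g =>
    (Subtype.ext_iff.trans (hspan g).symm : φ g = 0 ↔ _)
  have hφ : Function.Surjective φ := by
    intro w
    obtain ⟨hew, hwe⟩ := (Subsemigroup.mem_corner_iff he).1 w.2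
    obtain ⟨g, hg⟩ := hq w.1
    have hfg : f * g ∈ Ideal.span {f} := by
      rw [hspan, map_mul, hg, mul_assoc, hwe, ← hew, ← mul_assoc,
        (hspan f).1 (Ideal.mem_span_singleton_self f), zero_mul]
    exact ⟨⟨g, hfg⟩, Subtype.ext (by change q g * e = w.1; rw [hg, hwe])⟩
  exact ⟨(Ideal.quotientEquivAlgOfEq _ hker.symm).trans (Ideal.quotientKerAlgEquivOfSurjective hφ)⟩

end Corner

theorem IsGeneralisedAPolynomial.of_rightDvd (hσ : IsOfFinOrder σ) (hf : 1 ≤ f.degree)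
    {a : fixedSubfield σ} (ha : a ≠ 0) (hdvd : RightDvd f (t ^ orderOf σ - C (a : K))) :
    IsGeneralisedAPolynomial f := by
  have := CyclicAlgebra.isSimpleRing hσ ha
  have := CyclicAlgebra.isCentral hσ ha
  have := CyclicAlgebra.finiteDimensional (a := a) hσ
  have := IsArtinianRing.of_finite (fixedSubfield σ) (CyclicAlgebra σ a)
  have hker : RingHom.ker (CyclicAlgebra.mk a).toRingHom ≤ Ideal.span {f} := by
    rw [show RingHom.ker (CyclicAlgebra.mk a).toRingHom = _ from Ideal.mk_ker,
      Ideal.span_singleton_le_iff_mem]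
    exact rightDvd_iff_mem_span.1 hdvd
  have hmk : Function.Surjective (CyclicAlgebra.mk a) := Ideal.Quotient.mk_surjective
  obtain ⟨e, he, hspan⟩ := exists_isIdempotentElem_mem_iff_mul_eq_zero
    (q := (CyclicAlgebra.mk a).toRingHom) hmk hker
  have he0 : e ≠ 0 := by
    rintro rfl
    exact not_rightDvd_C hf one_ne_zero (rightDvd_iff_mem_span.2 ((hspan _).2 (mul_zero _)))
  obtain ⟨E⟩ := nonempty_eigenring_algEquiv_corner hmk he hspan
  have := isSimpleRing_corner he he0
  have := isCentral_corner (k := fixedSubfield σ) he he0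
  have := finite_corner (k := fixedSubfield σ) he
  exact
    { central := .of_algEquiv _ _ _ E.symm
      simple := .of_ringEquiv E.symm.toRingEquiv inferInstance
      finite := .equiv E.symm.toLinearEquiv }

theorem IsGeneralisedAPolynomial.exists_rightDvd (hf : IsGeneralisedAPolynomial f) :
    ∃ a : fixedSubfield σ, RightDvd f (t ^ orderOf σ - C (a : K)) := by
  have := hf.central
  let τ : idealiser f := ⟨t ^ orderOf σ, by
    change f * t ^ orderOf σ ∈ Ideal.span {f}
    rw [← (commute_t_pow_orderOf f).eq]
    exact Ideal.mul_mem_left _ _ (Ideal.mem_span_singleton_self f)⟩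
  let π : idealiser f →ₐ[fixedSubfield σ] Eigenring f :=
    Ideal.Quotient.mkₐ (fixedSubfield σ) (idealiserIdeal f)
  have hcentral : π τ ∈ Subalgebra.center (fixedSubfield σ) (Eigenring f) := by
    refine Subalgebra.mem_center_iff.2 fun x => ?_
    obtain ⟨g, rfl⟩ : ∃ g, π g = x := Ideal.Quotient.mk_surjective x
    rw [← map_mul, ← map_mul]
    exact congrArg π (Subtype.ext (commute_t_pow_orderOf g.1).eq.symm)
  obtain ⟨a, ha⟩ := (Algebra.IsCentral.mem_center_iff (fixedSubfield σ)).1 hcentral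
  refine ⟨a, rightDvd_iff_mem_span.2 ?_⟩
  have hker : τ - algebraMap _ _ a ∈ idealiserIdeal f :=
    Ideal.Quotient.eq.1 (ha.trans (π.commutes a).symm)
  exact hker

end Eigenring

section MinimalCentralLeftMultiple

variable {f h : TwistedPolynomial σ} {hhat : Polynomial (fixedSubfield σ)}

theorem IsMinimalCentralLeftMultiple.natDegree_le_one (hσ : IsOfFinOrder σ)
    (hmin : IsMinimalCentralLeftMultiple (orderOf σ) f h hhat) {a : fixedSubfield σ}
    (hdvd : RightDvd f (t ^ orderOf σ - C (a : K))) : hhat.natDegree ≤ 1 := by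
  have hn := hσ.orderOf_pos
  have hdegree : (hhat.natDegree * orderOf σ : ℕ) ≤ ((1 * orderOf σ : ℕ) : WithBot ℕ) :=
    calc ((hhat.natDegree * orderOf σ : ℕ) : WithBot ℕ)
        ≤ h.degree := hmin.eq_aeval ▸ natDegree_mul_le_degree_aeval_t_pow hn hmin.monic.ne_zero
      _ ≤ (t ^ orderOf σ - C (a : K)).degree :=
          hmin.minimal _ (t_pow_orderOf_sub_C_mem_center a) (t_pow_sub_C_ne_zero hn _) hdvd
      _ = (1 * orderOf σ : ℕ) := by rw [degree_t_pow_sub_C hn, one_mul]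
  exact Nat.le_of_mul_le_mul_right (WithBot.coe_le_coe.1 hdegree) hn

theorem eval_eq_zero_of_rightDvd_aeval {n : ℕ} (hf : 1 ≤ f.degree)
    {p : Polynomial (fixedSubfield σ)} (hp : RightDvd f (Polynomial.aeval (t ^ n) p))
    {a : fixedSubfield σ} (hdvd : RightDvd f (t ^ n - C (a : K))) : p.eval a = 0 := by
  by_contra heval
  refine not_rightDvd_C hf (c := (p.eval a : fixedSubfield σ)) (by exact_mod_cast heval) ?_
  obtain ⟨q, hq⟩ := Polynomial.X_sub_C_dvd_sub_C_eval (a := a) (p := p)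
  have hsub : Polynomial.aeval (t ^ n : TwistedPolynomial σ) p - C (↑(p.eval a) : K) =
      Polynomial.aeval (t ^ n) q * (t ^ n - C (a : K)) := by
    simpa [mul_comm, algebraMap_eq_C] using
      congrArg (Polynomial.aeval (t ^ n : TwistedPolynomial σ)) (hq.trans (mul_comm _ _))
  rw [rightDvd_iff_mem_span] at hp hdvd ⊢
  rw [← sub_sub_cancel (Polynomial.aeval (t ^ n : TwistedPolynomial σ) p) (C _), hsub]
  exact sub_mem hp (Ideal.mul_mem_left _ _ hdvd)

theorem IsMinimalCentralLeftMultiple.eq_X_sub_C_iff (hσ : IsOfFinOrder σ) (hf : 1 ≤ f.degree)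
    (hmin : IsMinimalCentralLeftMultiple (orderOf σ) f h hhat) (a : fixedSubfield σ) :
    hhat = Polynomial.X - Polynomial.C a ↔ RightDvd f (t ^ orderOf σ - C (a : K)) := by
  have hdvd := hmin.rightDvd
  rw [hmin.eq_aeval] at hdvd
  constructor
  · rintro rfl
    simpa [algebraMap_eq_C] using hdvd
  · intro ha
    refine Polynomial.eq_of_monic_of_dvd_of_natDegree_le (Polynomial.monic_X_sub_C a) hmin.monic
      (Polynomial.dvd_iff_isRoot.2 (eval_eq_zero_of_rightDvd_aeval hf hdvd ha)) ?_
    rw [Polynomial.natDegree_X_sub_C]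
    exact hmin.natDegree_le_one hσ ha

end MinimalCentralLeftMultiple

end TwistedPolynomial

theorem theorem5_general {K : Type*} [Field K] (σ : K ≃+* K) (n : ℕ) (hn : 0 < n)
    (hσ : orderOf σ = n) (f : TwistedPolynomial σ) (hdeg : 1 ≤ f.degree)
    (hgcrd : TwistedPolynomial.IsGCRD f TwistedPolynomial.t 1)
    (h : TwistedPolynomial σ) (hhat : Polynomial (fixedSubfield σ))
    (hmin : TwistedPolynomial.IsMinimalCentralLeftMultiple n f h hhat) :
    (TwistedPolynomial.IsGeneralisedAPolynomial f ↔
      ∃ a : fixedSubfield σ, hhat = Polynomial.X - Polynomial.C a) ∧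
    ((∃ a : fixedSubfield σ, hhat = Polynomial.X - Polynomial.C a) ↔
      ∃ a : fixedSubfield σ,
        TwistedPolynomial.RightDvd f
          (TwistedPolynomial.t ^ n - TwistedPolynomial.C (a : K))) ∧
    (∀ a : fixedSubfield σ,
      hhat = Polynomial.X - Polynomial.C a ↔
        TwistedPolynomial.RightDvd f
          (TwistedPolynomial.t ^ n - TwistedPolynomial.C (a : K))) := by
  subst hσ
  have hfin : IsOfFinOrder σ := orderOf_pos_iff.1 hn
  have hconstants := hmin.eq_X_sub_C_iff hfin hdeg
  refine ⟨?_, exists_congr hconstants, hconstants⟩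
  rw [exists_congr hconstants]
  refine ⟨fun hA => hA.exists_rightDvd, fun ⟨a, hdvd⟩ => ?_⟩
  have ha : a ≠ 0 := by
    rintro rfl
    refine hgcrd.not_rightDvd_t_pow hdeg (orderOf σ) ?_
    simpa only [ZeroMemClass.coe_zero, map_zero, sub_zero] using hdvd
  exact TwistedPolynomial.IsGeneralisedAPolynomial.of_rightDvd hfin hdeg ha hdvd

theorem theorem5 {K : Type*} [Field K] (σ : K ≃+* K) (n : ℕ) (hn : 0 < n) (hσ : orderOf σ = n)
    (f : TwistedPolynomial σ) (hdeg : 1 ≤ f.degree)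
    (hgcrd : TwistedPolynomial.IsGCRD f TwistedPolynomial.t 1)
    (h : TwistedPolynomial σ) (hhat : Polynomial (fixedSubfield σ))
    (hmin : TwistedPolynomial.IsMinimalCentralLeftMultiple n f h hhat)
    (hirr : Irreducible hhat) :
    (TwistedPolynomial.IsGeneralisedAPolynomial f ↔
      ∃ a : fixedSubfield σ, hhat = Polynomial.X - Polynomial.C a) ∧
    ((∃ a : fixedSubfield σ, hhat = Polynomial.X - Polynomial.C a) ↔
      ∃ a : fixedSubfield σ,
        TwistedPolynomial.RightDvd f
          (TwistedPolynomial.t ^ n - TwistedPolynomial.C (a : K))) ∧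
    (∀ a : fixedSubfield σ,
      hhat = Polynomial.X - Polynomial.C a ↔
        TwistedPolynomial.RightDvd f
          (TwistedPolynomial.t ^ n - TwistedPolynomial.C (a : K))) :=
  theorem5_general σ n hn hσ f hdeg hgcrd h hhat hmin
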